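/- A pushdown automaton $M=(Q,\Sigma',\Gamma,\delta,q_0,Z_0,F)$ is deterministic (a DPDA) if each $\delta(q,a,Z)$ with $a\in\Sigma'\cup\{\lambda\}$ has at most one element, and $\delta(q,\lambda,Z)\neq\emptyset$ implies $\delta(q,a,Z)=\emptyset$ for all $a\in\Sigma'$; it accepts by final state. It is $1$-reversal-bounded if in every accepting computation the size of the pushdown alternates between increasing and decreasing at most once. For a language $L$ over a finite alphabet $\Sigma'$ let $$\mathrm{suff}(L)=\{w : xw\in L \text{ for some } x\in\Sigma'^*\},\quad \mathrm{inf}(L)=\{w : xwy\in L\text{ for some }x,y\in\Sigma'^*\},\quad \mathrm{outf}(L)=\{xy : xwy\in L\text{ for some }w\in\Sigma'^*\}.$$ Let $\Sigma$ be a finite alphabet, $\$\notin\Sigma$ and $L\subseteq(\Sigma\cup\{\$\})^*$. For an operation $\varrho$ on languages over $\Sigma\cup\{\$\}$, the language $L$ is called $\varrho$-marked-dense if $\$\Sigma^*\$\subseteq\varrho(L)$. **Proposition.** For each $\varrho\in\{\mathrm{suff},\mathrm{inf},\mathrm{outf}\}$ the following problem is undecidable: given a finite alphabet $\Sigma$ and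 a $1$-reversal-bounded DPDA $M$ with input alphabet $\Sigma\cup\{\$\}$, decide whether the language accepted by $M$ is $\varrho$-marked-dense. That is, no algorithm halts with the correct answer on every such input $(\Sigma,M)$. -/

import Mathlib

/-! ### Pushdown automata -/

/-- A (nondeterministic) pushdown automaton with states `Q`, input alphabet `A` and pushdown
alphabet `Γ`. In `δ q a Z`, the argument `a = none` stands for a move on the empty word. -/
structure PDA (Q A Γ : Type) where
  /-- transition function -/
  δ : Q → Option A → Γ → Set (Q × List Γ)
  /-- there are only finitely many choices in each situation -/
  δ_finite : ∀ q a Z, (δ q a Z).Finite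
  /-- initial state -/
  q₀ : Q
  /-- initial pushdown symbol -/
  Z₀ : Γ
  /-- accepting states -/
  F : Set Q

namespace PDA

variable {Q A Γ : Type}

/-- Instantaneous descriptions: state, input still to be read, contents of the pushdown (the head
of the list is the top). -/
structure Config (Q A Γ : Type) where
  state : Q
  input : List A
  stack : List Γ

/-- One move of the automaton: the topmost symbol `Z` is replaced by the word `β`, while one input
letter or none is consumed. -/
inductive Step (M : PDA Q A Γ) : Config Q A Γ → Config Q A Γ → Prop
  | read {q p : Q} {a : A} {w : List A} {Z : Γ} {β s : List Γ}
      (h : (p, β) ∈ M.δ q (some a) Z) : Step M ⟨q, a :: w, Z :: s⟩ ⟨p, w, β ++ s⟩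
  | eps {q p : Q} {w : List A} {Z : Γ} {β s : List Γ}
      (h : (p, β) ∈ M.δ q none Z) : Step M ⟨q, w, Z :: s⟩ ⟨p, w, β ++ s⟩

/-- The initial configuration on input `w`. -/
def init (M : PDA Q A Γ) (w : List A) : Config Q A Γ := ⟨M.q₀, w, [M.Z₀]⟩

/-- A configuration is accepting if the input is used up and the state is accepting. -/
def Accepting (M : PDA Q A Γ) (c : Config Q A Γ) : Prop := c.input = [] ∧ c.state ∈ M.F

/-- The language accepted by final state. -/
def language (M : PDA Q A Γ) : Language A :=
  {w | ∃ c, Relation.ReflTransGen M.Step (M.init w) c ∧ M.Accepting c}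

/-- Determinism: at most one choice for each state, input letter (or empty word) and topmost
pushdown symbol, and no choice between a move on the empty word and a reading move. -/
def Deterministic (M : PDA Q A Γ) : Prop :=
  (∀ q a Z, (M.δ q a Z).Subsingleton) ∧
    ∀ q Z, (M.δ q none Z).Nonempty → ∀ a : A, M.δ q (some a) Z = ∅

/-- `cs` is the sequence of configurations of an accepting computation on `w`. -/
def IsAcceptingComputation (M : PDA Q A Γ) (w : List A) (cs : List (Config Q A Γ)) : Prop :=
  cs.IsChain M.Step ∧ cs.head? = some (M.init w) ∧ ∃ c, cs.getLast? = some c ∧ M.Accepting c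

/-- The number of alternations between increasing and decreasing in a sequence of numbers; the
first argument is the direction of the latest strict change (`some true` for increasing,
`some false` for decreasing, `none` if there was none yet). -/
def reversalsFrom : Option Bool → List ℕ → ℕ
  | d, x :: y :: t =>
    if x = y then reversalsFrom d (y :: t)
    else if x < y then
      (if d = some false then 1 else 0) + reversalsFrom (some true) (y :: t)
    else
      (if d = some true then 1 else 0) + reversalsFrom (some false) (y :: t)
  | _, _ => 0

/-- `M` is `l`-reversal-bounded: in every accepting computation, the size of the pushdown
alternates between increasing and decreasing at most `l` times. -/
def ReversalBounded (M : PDA Q A Γ) (l : ℕ) : Prop :=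
  ∀ w cs, M.IsAcceptingComputation w cs →
    reversalsFrom none (cs.map fun c => c.stack.length) ≤ l

end PDA

/-! ### Operations on languages and marked density -/

/-- The set of suffixes of words of `L`. -/
def suff {A : Type} (L : Language A) : Language A := {w | ∃ x, x ++ w ∈ L}

/-- The set of infixes of words of `L`. -/
def infx {A : Type} (L : Language A) : Language A := {w | ∃ x y, x ++ w ++ y ∈ L}

/-- The set of outfixes of words of `L`. -/
def outf {A : Type} (L : Language A) : Language A :=
  {v | ∃ x w y, v = x ++ y ∧ x ++ w ++ y ∈ L}

/-- `L`, over the alphabet `A` extended by a new marker `$`, is `ρ`-marked-dense: `$ A* $ ⊆ ρ(L)`.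
The marker is `none`, and the letter `a` of `A` is `some a`. -/
def MarkedDense {A : Type} (ρ : Language (Option A) → Language (Option A))
    (L : Language (Option A)) : Prop :=
  ∀ w : List A, [none] ++ w.map some ++ [none] ∈ ρ L

/-! ### Finite descriptions of pushdown automata, as inputs of algorithms -/

/-- A finite description of a pushdown automaton whose input alphabet is `Σ ∪ {$}`. States,
letters of `Σ` and pushdown symbols are numbered from `0`; the initial state and the initial
pushdown symbol have number `0`. -/
structure PDACode where
  /-- the number of letters of `Σ` -/
  letters : ℕ
  /-- the number of states other than the initial one -/
  states : ℕ
  /-- the number of pushdown symbols other than the initial one -/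
  symbols : ℕ
  /-- the numbers of the accepting states -/
  final : List ℕ
  /-- the table of transitions: an entry `(q, a, Z, p, β)` says that `(p, β)` belongs to
  `δ(q, a, Z)`; here `a` is `none` for the empty word, `some none` for the marker `$`, and
  `some (some i)` for the letter number `i`. Entries with a number out of range are ignored. -/
  table : List (ℕ × Option (Option ℕ) × ℕ × ℕ × List ℕ)

namespace PDACode

/-- Descriptions are tuples of numbers and lists. -/
def equivProd : PDACode ≃
    ℕ × ℕ × ℕ × List ℕ × List (ℕ × Option (Option ℕ) × ℕ × ℕ × List ℕ) where
  toFun D := (D.letters, D.states, D.symbols, D.final, D.table)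
  invFun t := ⟨t.1, t.2.1, t.2.2.1, t.2.2.2.1, t.2.2.2.2⟩
  left_inv _ := rfl
  right_inv _ := rfl

instance : Primcodable PDACode := Primcodable.ofEquiv _ equivProd

/-- The table entry for the transition from `(q, a, Z)` to `r`. -/
def entry {n m k : ℕ} (q : Fin n) (a : Option (Option (Fin k))) (Z : Fin m)
    (r : Fin n × List (Fin m)) : ℕ × Option (Option ℕ) × ℕ × ℕ × List ℕ :=
  (q.val, a.map (Option.map Fin.val), Z.val, r.1.val, r.2.map Fin.val)

theorem entry_injective {n m k : ℕ} (q : Fin n) (a : Option (Option (Fin k))) (Z : Fin m) :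
    Function.Injective (entry q a Z) := by
  rintro ⟨p, β⟩ ⟨p', β'⟩ h
  simp only [entry, Prod.mk.injEq, true_and] at h
  exact Prod.ext (Fin.val_injective h.1) (List.map_injective_iff.2 Fin.val_injective h.2)

/-- The pushdown automaton described by `D`. -/
def toPDA (D : PDACode) :
    PDA (Fin (D.states + 1)) (Option (Fin D.letters)) (Fin (D.symbols + 1)) where
  δ q a Z := {r | entry q a Z r ∈ D.table}
  δ_finite q a Z :=
    (List.finite_toSet D.table).preimage (entry_injective q a Z).injOn
  q₀ := 0
  Z₀ := 0
  F := {q | q.val ∈ D.final}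

/-- `D` describes a deterministic pushdown automaton that is `l`-reversal-bounded. -/
def IsDPDA (l : ℕ) (D : PDACode) : Prop :=
  D.toPDA.Deterministic ∧ D.toPDA.ReversalBounded l

end PDACode

/-! ### Undecidability -/

/-- It is undecidable, given an input `a` that satisfies `promise`, whether `P a` holds: no
algorithm halts with the correct answer on every input that satisfies `promise`. (Nothing is asked
of the algorithm on other inputs, where it need not even halt.) -/
def UndecidableGiven {α : Type} [Primcodable α] (promise P : α → Prop) : Prop :=
  ¬ ∃ f : α →. Bool, Partrec f ∧ ∀ a, promise a → ∃ b, b ∈ f a ∧ (b = true ↔ P a)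

/-! Halting is reduced to the failure of marked density. Consider a correspondence problem that asks
for a sequence `u` of dominoes with `p · lo(u) = up(u) · s`, and encode a candidate as `u # v`,
where `v` is a reversed word. A deterministic automaton with one reversal can test whether the
reversal of `v` is `p · lo(u)`, or whether it is `up(u) · s`: it pushes the images while reading `u`
and compares by popping while reading `v`. The letter before the first marker selects one of the two
tests, and the automaton accepts when the selected test fails. So `$w$` cannot be completed by
either letter exactly when `w` encodes a solution (`CheckState.accepts_start_iff`,
`CheckState.exists_correct_iff`).

Accepted words have the form `a$w$` with one letter `a` in front. For such languages the three kinds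
of marked density coincide, so one family of automata serves all three.

The correspondence problem is undecidable because its solutions spell out derivations of a semi-Thue
system (`Correspondence.exists_of_derives`, `Correspondence.derives_of_eq`), and these simulate a
Turing machine (`ConfigLetter.eval_dom_iff`). Machine, rules and dominoes stay fixed; only a number
`n` varies. The machine runs on `2 ^ n`, whose binary digits are `n` zeros and a one, so the first
word is `a xⁿ b` and `n` enters the automaton through a single pushed word. This makes the reduction
visibly computable. -/

open Turing

/-! ### An undecidable halting problem -/

/-- There is a partial recursive function whose domain is undecidable on the powers of `2`. -/
theorem exists_nat_partrec_pow_two_undecidable :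
    ∃ g : ℕ →. ℕ, Partrec g ∧ ¬ ComputablePred fun n => (g (2 ^ n)).Dom := by
  let f : ℕ →. ℕ := fun m => Nat.Partrec.Code.eval (Denumerable.ofNat Nat.Partrec.Code m) 0
  have hf : Partrec f :=
    Nat.Partrec.Code.eval_part.comp (Computable.ofNat _) (Computable.const 0)
  have hpow : Computable fun n : ℕ => 2 ^ n := by
    refine ((Primrec.nat_iterate Primrec.id (Primrec.const 1)
      (Primrec.nat_mul.comp (Primrec.const 2) Primrec.snd).to₂).of_eq fun n => ?_).to_comp
    simp
  -- The partial logarithm to base 2: following it by `f` moves the halting problem of code number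
  -- `n` to the argument `2 ^ n`.
  have hlog : Partrec fun k : ℕ => Nat.rfind fun m => Part.some (decide (2 ^ m = k)) := by
    refine Partrec.rfind ?_
    have : Computable fun p : ℕ × ℕ => decide (2 ^ p.2 = p.1) :=
      (Primrec.eq.decide.to_comp).comp (hpow.comp Computable.snd) Computable.fst
    exact this
  refine ⟨fun k => (Nat.rfind fun m => Part.some (decide (2 ^ m = k))).bind f,
    hlog.bind (hf.comp Computable.snd), fun h => ?_⟩
  have key : ∀ n : ℕ, (Nat.rfind fun m => Part.some (decide (2 ^ m = 2 ^ n))) = Part.some n := by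
    intro n
    refine Part.eq_some_iff.2 (Nat.mem_rfind.2 ⟨by simp, fun {m} hm => ?_⟩)
    have : (2 : ℕ) ^ m ≠ 2 ^ n := (Nat.pow_lt_pow_right (by norm_num) hm).ne
    simpa using this
  refine ComputablePred.halting_problem 0 ?_
  simp only [key] at h
  obtain ⟨hd, hc⟩ := h
  refine ⟨fun c => Classical.dec _, (hc.comp Computable.encode).of_eq fun c => ?_⟩
  simp [f]

theorem exists_toPartrec_code_pow_two_undecidable :
    ∃ c : ToPartrec.Code, ¬ ComputablePred fun n => (c.eval [2 ^ n]).Dom := by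
  obtain ⟨g, hg, hn⟩ := exists_nat_partrec_pow_two_undecidable
  obtain ⟨c, hc⟩ := ToPartrec.Code.exists_code (Nat.Partrec'.part_iff₁.2 hg)
  refine ⟨c, fun h => hn ?_⟩
  convert! h using 2 with n
  have := hc ⟨[2 ^ n], rfl⟩
  simp only at this
  rw [this]
  simp [List.Vector.head]

theorem trNat_pow_two (n : ℕ) :
    PartrecToTM2.trNat (2 ^ n) =
      List.replicate n PartrecToTM2.Γ'.bit0 ++ [PartrecToTM2.Γ'.bit1] := by
  have key : ∃ p : PosNum, ((2 ^ n : ℕ) : Num) = Num.pos p ∧ PartrecToTM2.trPosNum p =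
      List.replicate n PartrecToTM2.Γ'.bit0 ++ [PartrecToTM2.Γ'.bit1] := by
    induction n with
    | zero => exact ⟨PosNum.one, by simp; rfl, rfl⟩
    | succ n ih =>
      obtain ⟨p, hp, hq⟩ := ih
      refine ⟨p.bit0, ?_, by simp [PartrecToTM2.trPosNum, hq, List.replicate_succ]⟩
      have : ((2 ^ (n + 1) : ℕ) : Num) = ((2 ^ n : ℕ) : Num) + ((2 ^ n : ℕ) : Num) := by
        rw [pow_succ, mul_two, Nat.cast_add]
      rw [this, hp, Num.bit0_of_bit0]
      rfl
  obtain ⟨p, hp, hq⟩ := key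
  rw [PartrecToTM2.trNat, hp]
  exact hq

instance : Finite PartrecToTM2.K' :=
  Finite.of_injective (β := Fin 4)
    (fun k => match k with | .main => 0 | .rev => 1 | .aux => 2 | .stack => 3)
    (by rintro (_ | _ | _ | _) (_ | _ | _ | _) h <;> simp_all)

/-- There is a machine with finitely many states and symbols whose halting problem, on inputs
consisting of a fixed word followed by `n` copies of a fixed symbol, is undecidable. -/
theorem exists_TM0_undecidable :
    ∃ (Γ Λ : Type) (_ : Inhabited Γ) (_ : Finite Γ) (_ : Inhabited Λ) (M : TM0.Machine Γ Λ)
      (S : Finset Λ) (_ : TM0.Supports M S) (a : List Γ) (x : Γ),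
      ¬ ComputablePred fun n => (TM0.eval M (a ++ List.replicate n x)).Dom := by
  obtain ⟨c, hc⟩ := exists_toPartrec_code_pow_two_undecidable
  let : Inhabited PartrecToTM2.Λ' := ⟨PartrecToTM2.trNormal c PartrecToTM2.Cont'.halt⟩
  have := Fintype.ofFinite PartrecToTM2.K'
  let M : PartrecToTM2.Λ' →
    TM2.Stmt (fun _ : PartrecToTM2.K' => PartrecToTM2.Γ') PartrecToTM2.Λ'
      (Option PartrecToTM2.Γ') := PartrecToTM2.tr
  have hsupp := TM1to0.tr_supports _
    (TM2to1.tr_supports M (PartrecToTM2.tr_supports c PartrecToTM2.Cont'.halt))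
  let e : PartrecToTM2.Γ' → TM2to1.Γ' PartrecToTM2.K' (fun _ => PartrecToTM2.Γ') := fun a =>
    (false, Function.update (fun _ => none) PartrecToTM2.K'.main (some a))
  -- The bottom of the input stack lies at the left end of the tape, in a cell flagged `true`. Read
  -- from there, the list `[2 ^ n]` is the end mark, the leading one and then the zeros.
  let a : List (TM2to1.Γ' PartrecToTM2.K' fun _ => PartrecToTM2.Γ') :=
    [(true, (e .cons).2), e .bit1]
  have hinput : ∀ n, TM2to1.trInit (Γ := fun _ => PartrecToTM2.Γ') PartrecToTM2.K'.main
      (PartrecToTM2.trList [2 ^ n]) = a ++ List.replicate n (e .bit0) := by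
    intro n
    have h : (PartrecToTM2.trList [2 ^ n]).reverse = .cons :: .bit1 :: List.replicate n .bit0 := by
      simp [PartrecToTM2.trList, trNat_pow_two]
    rw [TM2to1.trInit, h]
    change a ++ (List.replicate n PartrecToTM2.Γ'.bit0).map e = _
    rw [List.map_replicate]
  have hdom : ∀ n, (TM0.eval (TM1to0.tr (TM2to1.tr M)) (a ++ List.replicate n (e .bit0))).Dom ↔
      (c.eval [2 ^ n]).Dom := by
    intro n
    rw [← hinput, TM1to0.tr_eval]
    refine (TM2to1.tr_eval_dom M _ _).trans ?_
    have h1 : TM2.init PartrecToTM2.K'.main (PartrecToTM2.trList [2 ^ n]) =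
        PartrecToTM2.init c [2 ^ n] := by
      simp only [TM2.init, PartrecToTM2.init]
      congr 1
      funext k
      cases k <;> simp [Function.update]
    have h2 := PartrecToTM2.tr_eval c [2 ^ n]
    rw [← h1] at h2
    change (Part.map _ (StateTransition.eval (TM2.step PartrecToTM2.tr) _)).Dom ↔ _
    rw [h2]
    rfl
  refine ⟨_, _, inferInstance, Finite.of_fintype _, inferInstance, TM1to0.tr (TM2to1.tr M), _,
    hsupp, a, e .bit0, fun h => hc ?_⟩
  convert! h using 2 with n
  exact (hdom n).symm

/-! ### Semi-Thue systems -/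

/-- One step of rewriting with the rules `R`. -/
inductive Rewrites {A : Type} (R : Set (List A × List A)) : List A → List A → Prop
  | intro {l r : List A} (x y : List A) (h : (l, r) ∈ R) : Rewrites R (x ++ l ++ y) (x ++ r ++ y)

/-- Rewriting in any number of steps. -/
abbrev Derives {A : Type} (R : Set (List A × List A)) : List A → List A → Prop :=
  Relation.ReflTransGen (Rewrites R)

theorem Rewrites.append {A : Type} {R : Set (List A × List A)} {u v : List A}
    (h : Rewrites R u v) (x y : List A) : Rewrites R (x ++ u ++ y) (x ++ v ++ y) := by
  cases h with
  | intro x' y' h => simpa using Rewrites.intro (x ++ x') (y' ++ y) h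

theorem Derives.append {A : Type} {R : Set (List A × List A)} {u v : List A}
    (h : Derives R u v) (x y : List A) : Derives R (x ++ u ++ y) (x ++ v ++ y) :=
  h.lift (fun w => x ++ w ++ y) fun _ _ h => h.append x y

/-! ### Turing machines as semi-Thue systems -/

/-- The letters of words describing configurations of a Turing machine: tape symbols, states, a
letter for the halted machine, and brackets. -/
inductive ConfigLetter (Γ Λ : Type) : Type
  | sym (a : Γ)
  | st (q : Λ)
  | halt
  | left
  | right

namespace ConfigLetter

variable {Γ Λ : Type}

instance [Finite Γ] [Finite Λ] : Finite (ConfigLetter Γ Λ) :=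
  Finite.of_injective (β := Γ ⊕ Λ ⊕ Fin 3)
    (fun c => match c with
      | .sym a => .inl a
      | .st q => .inr (.inl q)
      | .halt => .inr (.inr 0)
      | .left => .inr (.inr 1)
      | .right => .inr (.inr 2))
    (by rintro (_ | _ | _ | _ | _) (_ | _ | _ | _ | _) h <;> simp_all)

/-- The word describing a configuration, given by the state, the tape symbols to the left of the
head (the nearest first), and those from the head on to the right. -/
def word {S : Finset Λ} (q : S) (l r : List Γ) : List (ConfigLetter Γ S) :=
  left :: (l.reverse.map sym ++ st q :: (r.map sym ++ [right]))

/-- The word describing the halted machine. -/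
def haltWord (S : Finset Λ) : List (ConfigLetter Γ S) := [left, halt, right]

theorem word_eq_iff {S : Finset Λ} {q q' : S} {l r : List Γ} {x y : List (ConfigLetter Γ S)} :
    x ++ st q' :: y = word q l r ↔
      x = left :: l.reverse.map sym ∧ q' = q ∧ y = r.map sym ++ [right] := by
  rw [word, ← List.cons_append, eq_comm, List.append_cons_inj_of_notMem (by simp) (by simp)]
  simp only [eq_comm, ConfigLetter.st.injEq]

theorem map_sym_eq {S : Finset Λ} {y : List (ConfigLetter Γ S)} {a : Γ} {r : List Γ} :
    sym a :: y = r.map sym ++ [right] ↔ ∃ r', r = a :: r' ∧ y = r'.map sym ++ [right] := by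
  cases r <;> simp; grind

variable [Inhabited Γ]

/-- The configuration described by `word q l r`. -/
def cfg {S : Finset Λ} (q : S) (l r : List Γ) : TM0.Cfg Γ Λ :=
  ⟨q.1, Tape.mk' (ListBlank.mk l) (ListBlank.mk r)⟩

theorem cfg_nil {S : Finset Λ} (q : S) (l : List Γ) : cfg q l [] = cfg q l [default] := by
  simp only [cfg]
  congr 2
  exact Quotient.sound' (Or.inl ⟨1, rfl⟩)

theorem cfg_left_nil {S : Finset Λ} (q : S) (r : List Γ) : cfg q [] r = cfg q [default] r := by
  simp only [cfg]
  congr 2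
  exact Quotient.sound' (Or.inl ⟨1, rfl⟩)

variable [Inhabited Λ]

/-- The rewriting rules that simulate a Turing machine. -/
inductive Rule (M : TM0.Machine Γ Λ) (S : Finset Λ) :
    List (ConfigLetter Γ S) → List (ConfigLetter Γ S) → Prop
  | write {q q' : S} {a b : Γ} (h : M q a = some (q'.1, .write b)) :
      Rule M S [st q, sym a] [st q', sym b]
  | moveRight {q q' : S} {a : Γ} (h : M q a = some (q'.1, .move .right)) :
      Rule M S [st q, sym a] [sym a, st q']
  | moveLeft {q q' : S} {a : Γ} (c : Γ) (h : M q a = some (q'.1, .move .left)) :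
      Rule M S [sym c, st q, sym a] [st q', sym c, sym a]
  | moveLeftEnd {q q' : S} {a : Γ} (h : M q a = some (q'.1, .move .left)) :
      Rule M S [left, st q, sym a] [left, st q', sym default, sym a]
  | blank (q : S) : Rule M S [st q, right] [st q, sym default, right]
  | halted {q : S} {a : Γ} (h : M q a = none) : Rule M S [st q, sym a] [halt]
  | eraseLeft (a : Γ) : Rule M S [sym a, halt] [halt]
  | eraseRight (a : Γ) : Rule M S [halt, sym a] [halt]

/-- The semi-Thue system of a Turing machine. -/
def rules (M : TM0.Machine Γ Λ) (S : Finset Λ) :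
    Set (List (ConfigLetter Γ S) × List (ConfigLetter Γ S)) := {p | Rule M S p.1 p.2}

theorem finite_rules [Finite Γ] (M : TM0.Machine Γ Λ) (S : Finset Λ) : (rules M S).Finite := by
  refine ((List.finite_length_le (ConfigLetter Γ S) 4).prod
    (List.finite_length_le (ConfigLetter Γ S) 4)).subset ?_
  rintro ⟨l, r⟩ (h : Rule M S l r)
  cases h <;> simp

variable {M : TM0.Machine Γ Λ} {S : Finset Λ}

theorem rewrites_word_nil (q : S) (l : List Γ) :
    Rewrites (rules M S) (word q l []) (word q l [default]) := by
  simpa [word] using Rewrites.intro (R := rules M S) (left :: l.reverse.map sym) [] (Rule.blank q)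

theorem step_cfg (q : S) (l : List Γ) (a : Γ) (r : List Γ) :
    TM0.step M (cfg q l (a :: r)) = (M q a).map fun p => ⟨p.1, match p.2 with
      | .move d => (Tape.mk' (ListBlank.mk l) (ListBlank.mk (a :: r))).move d
      | .write b => (Tape.mk' (ListBlank.mk l) (ListBlank.mk (a :: r))).write b⟩ := rfl

theorem step_cfg_write {q q' : S} {a b : Γ} (h : M q a = some (q'.1, .write b))
    (l r : List Γ) : TM0.step M (cfg q l (a :: r)) = some (cfg q' l (b :: r)) := by
  rw [step_cfg, h]; rfl

theorem step_cfg_moveRight {q q' : S} {a : Γ} (h : M q a = some (q'.1, .move .right))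
    (l r : List Γ) : TM0.step M (cfg q l (a :: r)) = some (cfg q' (a :: l) r) := by
  rw [step_cfg, h]
  simp [cfg, Tape.move_right_mk', ListBlank.tail_mk, ListBlank.head_mk, ListBlank.cons_mk]

theorem step_cfg_moveLeft {q q' : S} {a : Γ} (h : M q a = some (q'.1, .move .left))
    (c : Γ) (l r : List Γ) :
    TM0.step M (cfg q (c :: l) (a :: r)) = some (cfg q' l (c :: a :: r)) := by
  rw [step_cfg, h]
  simp [cfg, Tape.move_left_mk', ListBlank.tail_mk, ListBlank.head_mk, ListBlank.cons_mk]

theorem step_cfg_moveLeftEnd {q q' : S} {a : Γ} (h : M q a = some (q'.1, .move .left))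
    (r : List Γ) :
    TM0.step M (cfg q [] (a :: r)) = some (cfg q' [] (default :: a :: r)) := by
  rw [cfg_left_nil, step_cfg_moveLeft h]

/-- The machine's steps are simulated by rewriting. -/
theorem exists_rewrites_of_step (hS : TM0.Supports M S) {q : S} {l : List Γ} {a : Γ} {r : List Γ}
    {c : TM0.Cfg Γ Λ} (h : c ∈ TM0.step M (cfg q l (a :: r))) :
    ∃ q' l' r', c = cfg q' l' r' ∧ Rewrites (rules M S) (word q l (a :: r)) (word q' l' r') := by
  rcases hq : M q a with _ | ⟨p, s⟩
  · simp [step_cfg, hq] at h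
  obtain ⟨q', rfl⟩ : ∃ q' : S, q'.1 = p := ⟨⟨p, hS.2 hq q.2⟩, rfl⟩
  rcases s with (_ | _) | b
  · cases l with
    | nil =>
      rw [step_cfg_moveLeftEnd hq] at h
      refine ⟨q', _, _, (Option.some.inj h).symm, ?_⟩
      simpa [word] using Rewrites.intro (R := rules M S) [] (r.map sym ++ [right])
        (Rule.moveLeftEnd hq)
    | cons c l =>
      rw [step_cfg_moveLeft hq] at h
      refine ⟨q', _, _, (Option.some.inj h).symm, ?_⟩
      simpa [word] using Rewrites.intro (R := rules M S) (left :: l.reverse.map sym)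
        (r.map sym ++ [right]) (Rule.moveLeft c hq)
  · rw [step_cfg_moveRight hq] at h
    refine ⟨q', _, _, (Option.some.inj h).symm, ?_⟩
    simpa [word] using Rewrites.intro (R := rules M S) (left :: l.reverse.map sym)
      (r.map sym ++ [right]) (Rule.moveRight hq)
  · rw [step_cfg_write hq] at h
    refine ⟨q', _, _, (Option.some.inj h).symm, ?_⟩
    simpa [word] using Rewrites.intro (R := rules M S) (left :: l.reverse.map sym)
      (r.map sym ++ [right]) (Rule.write hq)

theorem derives_erase (l r : List Γ) :
    Derives (rules M S) (left :: (l.reverse.map sym ++ halt :: (r.map sym ++ [right])))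
      (haltWord S) := by
  induction r with
  | nil =>
    induction l with
    | nil => exact .refl
    | cons a l ih =>
      refine .head ?_ ih
      simpa using Rewrites.intro (R := rules M S) (left :: l.reverse.map sym)
        [right] (Rule.eraseLeft a)
  | cons a r ih =>
    refine .head ?_ ih
    simpa using Rewrites.intro (R := rules M S) (left :: l.reverse.map sym)
      (r.map sym ++ [right]) (Rule.eraseRight a)

/-- Several words describe the same configuration, since trailing blanks may be omitted; hence the
quantification over all of them. If no symbol is left under the head, the rule `blank` supplies one
first. -/
theorem derives_haltWord (hS : TM0.Supports M S) {c d : TM0.Cfg Γ Λ}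
    (h : StateTransition.Reaches (TM0.step M) c d) (hd : TM0.step M d = none) :
    ∀ (q : S) (l r : List Γ), c = cfg q l r → Derives (rules M S) (word q l r) (haltWord S) := by
  induction h using Relation.ReflTransGen.head_induction_on with
  | refl =>
    have key : ∀ (q : S) (l : List Γ) (a : Γ) (r : List Γ), d = cfg q l (a :: r) →
        Derives (rules M S) (word q l (a :: r)) (haltWord S) := by
      rintro q l a r rfl
      refine .head ?_ (derives_erase l r)
      simpa [word] using Rewrites.intro (R := rules M S) (left :: l.reverse.map sym)
        (r.map sym ++ [right]) (Rule.halted (q := q) (a := a) (by simpa [step_cfg] using hd))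
    rintro q l (_ | ⟨a, r⟩) h
    · exact .head (rewrites_word_nil q l) (key q l _ _ (h.trans (cfg_nil q l)))
    · exact key q l a r h
  | @head c c' h _ ih =>
    have key : ∀ (q : S) (l : List Γ) (a : Γ) (r : List Γ), c = cfg q l (a :: r) →
        Derives (rules M S) (word q l (a :: r)) (haltWord S) := by
      rintro q l a r rfl
      obtain ⟨q', l', r', hc, hr⟩ := exists_rewrites_of_step hS h
      exact .head hr (ih q' l' r' hc)
    rintro q l (_ | ⟨a, r⟩) h
    · exact .head (rewrites_word_nil q l) (key q l _ _ (h.trans (cfg_nil q l)))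
    · exact key q l a r h

/-- Rewriting a word that describes a configuration simulates the machine. -/
theorem of_rewrites_word {q : S} {l r : List Γ} {w : List (ConfigLetter Γ S)}
    (h : Rewrites (rules M S) (word q l r) w) :
    TM0.step M (cfg q l r) = none ∨ ∃ q' l' r', w = word q' l' r' ∧
      (cfg q' l' r' = cfg q l r ∨ TM0.step M (cfg q l r) = some (cfg q' l' r')) := by
  generalize hw : word q l r = v at h
  obtain ⟨x, y, h⟩ := h
  cases h with
  | @write p p' a b h =>
    obtain ⟨rfl, rfl, hy⟩ := word_eq_iff.1 (by simpa using hw.symm :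
      x ++ st p :: (sym a :: y) = word q l r)
    obtain ⟨r', rfl, rfl⟩ := map_sym_eq.1 hy
    exact .inr ⟨p', l, b :: r', by simp [word], .inr (step_cfg_write h l r')⟩
  | @moveRight p p' a h =>
    obtain ⟨rfl, rfl, hy⟩ := word_eq_iff.1 (by simpa using hw.symm :
      x ++ st p :: (sym a :: y) = word q l r)
    obtain ⟨r', rfl, rfl⟩ := map_sym_eq.1 hy
    exact .inr ⟨p', a :: l, r', by simp [word], .inr (step_cfg_moveRight h l r')⟩
  | @moveLeft p p' a c h =>
    obtain ⟨hx, rfl, hy⟩ := word_eq_iff.1 (by simpa using hw.symm :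
      (x ++ [sym c]) ++ st p :: (sym a :: y) = word q l r)
    obtain ⟨r', rfl, rfl⟩ := map_sym_eq.1 hy
    rcases l with _ | ⟨c', l⟩
    · rcases x with _ | ⟨_, _⟩ <;> simp at hx
    · obtain ⟨rfl, hc⟩ := List.append_inj' (hx.trans (by simp :
        _ = (left :: l.reverse.map sym) ++ [sym c'])) rfl
      obtain rfl : c = c' := by simpa using hc
      exact .inr ⟨p', l, c :: a :: r', by simp [word], .inr (step_cfg_moveLeft h c l r')⟩
  | @moveLeftEnd p p' a h =>
    obtain ⟨hx, rfl, hy⟩ := word_eq_iff.1 (by simpa using hw.symm :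
      (x ++ [left]) ++ st p :: (sym a :: y) = word q l r)
    obtain ⟨r', rfl, rfl⟩ := map_sym_eq.1 hy
    rcases l with _ | ⟨c', l⟩
    · obtain rfl : x = [] := by simpa using hx
      exact .inr ⟨p', [], default :: a :: r', by simp [word], .inr (step_cfg_moveLeftEnd h r')⟩
    · obtain ⟨-, hc⟩ := List.append_inj' (hx.trans (by simp :
        _ = (left :: l.reverse.map sym) ++ [sym c'])) rfl
      simp at hc
  | blank p =>
    obtain ⟨rfl, rfl, hy⟩ := word_eq_iff.1 (by simpa using hw.symm :
      x ++ st p :: (right :: y) = word q l r)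
    rcases r with _ | ⟨a, r⟩
    · obtain rfl : y = [] := by simpa using hy
      exact .inr ⟨p, l, [default], by simp [word], .inl (cfg_nil p l).symm⟩
    · simp at hy
  | @halted p a h =>
    obtain ⟨rfl, rfl, hy⟩ := word_eq_iff.1 (by simpa using hw.symm :
      x ++ st p :: (sym a :: y) = word q l r)
    obtain ⟨r', rfl, rfl⟩ := map_sym_eq.1 hy
    exact .inl (by simp [step_cfg, h])
  -- The erasing rules need the letter `halt`, which a configuration word does not contain.
  | _ =>
    have : halt ∉ word q l r := by simp [word]
    simp [hw] at this

/-- As long as the machine has not halted, a rewriting step either pads with a blank or performs the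
machine's unique next step, so a derivation cannot escape the run. -/
theorem dom_of_derives (q : S) (l r : List Γ)
    (h : Derives (rules M S) (word q l r) (haltWord S)) :
    (StateTransition.eval (TM0.step M) (cfg q l r)).Dom := by
  generalize hw : word q l r = w at h
  induction h using Relation.ReflTransGen.head_induction_on generalizing q l r with
  | refl => exact absurd hw.symm (by
      have : st q ∉ (haltWord S : List (ConfigLetter Γ S)) := by simp [haltWord]
      intro h; rw [h] at this; simp [word] at this)
  | head h _ ih =>
    subst hw
    rcases of_rewrites_word h with h | ⟨q', l', r', rfl, h | h⟩
    · exact Part.dom_iff_mem.2 ⟨_, StateTransition.mem_eval.2 ⟨.refl, h⟩⟩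
    · exact h ▸ ih q' l' r' rfl
    · rw [StateTransition.reaches_eval (Relation.ReflTransGen.single h)]
      exact ih q' l' r' rfl

theorem eval_dom_iff (hS : TM0.Supports M S) (l : List Γ) :
    (TM0.eval M l).Dom ↔ Derives (rules M S) (word ⟨default, hS.1⟩ [] l) (haltWord S) := by
  have : (TM0.eval M l).Dom ↔
    (StateTransition.eval (TM0.step M) (cfg (⟨default, hS.1⟩ : S) [] l)).Dom := Iff.rfl
  rw [this]
  refine ⟨fun h => ?_, dom_of_derives _ _ _⟩
  obtain ⟨d, hd⟩ := Part.dom_iff_mem.1 h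
  obtain ⟨h1, h2⟩ := StateTransition.mem_eval.1 hd
  exact derives_haltWord hS h1 h2 _ _ _ rfl

end ConfigLetter

/-! ### A correspondence problem -/

namespace Correspondence

variable {A : Type} {R : Set (List A × List A)}

/-- The upper words of the dominoes of a semi-Thue system: copying dominoes for all letters and for
the separator `none`, and one domino for every rule. -/
def upper : Option A ⊕ R → List (Option A)
  | .inl b => [b]
  | .inr r => r.1.1.map some

/-- The lower words of the dominoes. -/
def lower : Option A ⊕ R → List (Option A)
  | .inl b => [b]
  | .inr r => r.1.2.map some

/-- The lower row runs one word ahead of the upper: the upper spells all words of the derivation but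
the last, the lower all but the first. A single rewriting step is one rule domino amid copying
dominoes. -/
theorem exists_of_derives {c d : List A} (h : Derives R c d) :
    ∃ u : List (Option A ⊕ R), (c.map some ++ [none]) ++ u.flatMap lower =
      u.flatMap upper ++ (d.map some ++ [none]) := by
  induction h using Relation.ReflTransGen.head_induction_on with
  | refl => exact ⟨[], by simp⟩
  | head h _ ih =>
    obtain ⟨u, hu⟩ := ih
    obtain ⟨x, y, h⟩ := h
    have hl (z : List A) : (z.map fun a => (Sum.inl (some a) : Option A ⊕ R)).flatMap lower =
        z.map some := by
      induction z <;> simp_all [lower]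
    have hu' (z : List A) : (z.map fun a => (Sum.inl (some a) : Option A ⊕ R)).flatMap upper =
        z.map some := by
      induction z <;> simp_all [upper]
    refine ⟨x.map (fun a => .inl (some a)) ++ .inr ⟨_, h⟩ :: y.map (fun a => .inl (some a)) ++
      .inl none :: u, ?_⟩
    simp only [List.map_append, List.append_assoc, List.flatMap_append, List.flatMap_cons, hl, hu']
      at hu ⊢
    rw [← hu]
    simp [upper, lower]

/-- A block of dominoes without separator applies rules at disjoint places, in any number, and
copies the rest. -/
theorem exists_derives_of_notMem {u : List (Option A ⊕ R)} (hu : .inl none ∉ u) :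
    ∃ c d : List A, u.flatMap upper = c.map some ∧ u.flatMap lower = d.map some ∧
      Derives R c d := by
  induction u with
  | nil => exact ⟨[], [], by simp, by simp, .refl⟩
  | cons i u ih =>
    obtain ⟨hi, hu⟩ := not_or.1 (List.mem_cons.not.1 hu)
    obtain ⟨c, d, hc, hd, h⟩ := ih hu
    rcases i with (_ | a) | ⟨⟨l, r⟩, hr⟩
    · exact absurd rfl hi
    · exact ⟨a :: c, a :: d, by simp [upper, hc], by simp [lower, hd],
        by simpa using h.append [a] []⟩
    · refine ⟨l ++ c, r ++ d, by simp [upper, hc], by simp [lower, hd], ?_⟩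
      exact .head (by simpa using Rewrites.intro [] c hr) (by simpa using h.append r [])

theorem map_some_append_none_inj {c d : List A} {x y : List (Option A)}
    (h : c.map some ++ none :: x = d.map some ++ none :: y) : c = d ∧ x = y := by
  induction c generalizing d with
  | nil => cases d <;> simp_all
  | cons a c ih =>
    cases d with
    | nil => simp at h
    | cons b d =>
      simp only [List.map_cons, List.cons_append, List.cons.injEq, Option.some.injEq] at h
      obtain ⟨rfl, h⟩ := h
      simpa using ih h

/-- Cut at the first separator domino: the block above must spell `c`, and the block below is the
word that takes over the role of `c` for the remaining dominoes. -/
theorem derives_of_eq {c d : List A} {u : List (Option A ⊕ R)}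
    (h : (c.map some ++ [none]) ++ u.flatMap lower = u.flatMap upper ++ (d.map some ++ [none])) :
    Derives R c d := by
  induction hn : u.length using Nat.strong_induction_on generalizing c u with
  | _ n ih =>
    by_cases hu : .inl none ∈ u
    · obtain ⟨v, w, rfl, hv⟩ := List.eq_append_cons_of_mem hu
      obtain ⟨c', d', hc, hd, hcd⟩ := exists_derives_of_notMem hv
      simp only [List.flatMap_append, List.flatMap_cons, hc, hd, upper, lower] at h
      obtain ⟨rfl, h⟩ := map_some_append_none_inj (by simpa using h :
        c.map some ++ none :: (d'.map some ++ none :: w.flatMap lower) =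
          c'.map some ++ none :: (w.flatMap upper ++ (d.map some ++ [none])))
      exact hcd.trans (ih w.length (by simp at hn; omega) (by simpa using h) rfl)
    · obtain ⟨c', d', hc, hd, hcd⟩ := exists_derives_of_notMem hu
      rw [hc, hd] at h
      -- The right side has only its final separator, so `d'` is empty, `c` is `c' ++ d`, and `c'`
      -- derives the empty word.
      obtain ⟨rfl, h⟩ := map_some_append_none_inj (by simpa using h :
        c.map some ++ none :: d'.map some = (c' ++ d).map some ++ none :: [])
      obtain rfl : d' = [] := by simpa using h
      simpa using hcd.append [] d

/-- There is a correspondence problem, with a parametrised first word `a xⁿ b` above and a last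
word `s` below, that is undecidable. -/
theorem exists_undecidable :
    ∃ (I B : Type) (_ : Finite I) (_ : Finite B) (up lo : I → List B) (a : List B) (x : B)
      (b s : List B), ¬ ComputablePred fun n =>
        ∃ u : List I, (a ++ List.replicate n x ++ b) ++ u.flatMap lo = u.flatMap up ++ s := by
  obtain ⟨Γ, Λ, _, _, _, M, S, hS, a, x, h⟩ := exists_TM0_undecidable
  have := (ConfigLetter.finite_rules M S).to_subtype
  refine ⟨Option (ConfigLetter Γ S) ⊕ ConfigLetter.rules M S, Option (ConfigLetter Γ S),
    inferInstance, inferInstance, upper, lower,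
    .some .left :: .some (.st ⟨default, hS.1⟩) :: a.map (fun c => some (.sym c)), some (.sym x),
    [some .right, none], (ConfigLetter.haltWord S).map some ++ [none], fun hc => h ?_⟩
  convert! hc using 2 with n
  rw [ConfigLetter.eval_dom_iff hS]
  have hw : ((ConfigLetter.word (⟨default, hS.1⟩ : S) [] (a ++ List.replicate n x)).map some ++
      [none] : List (Option (ConfigLetter Γ S))) =
      .some .left :: .some (.st ⟨default, hS.1⟩) :: a.map (fun c => some (.sym c)) ++
      List.replicate n (some (.sym x)) ++ [some .right, none] := by
    simp [ConfigLetter.word]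
  rw [← hw]
  exact ⟨exists_of_derives, fun ⟨_, hu⟩ => derives_of_eq hu⟩

end Correspondence

/-! ### Runs of real-time deterministic pushdown automata -/

/-- Acceptance of an input from a state and a pushdown, for the deterministic automaton without
moves on the empty word whose transition function is `next`. -/
def Accepts {Q A Γ : Type} (next : Q → A → Γ → Option (Q × List Γ)) (F : List Q) :
    Q → List A → List Γ → Prop
  | q, [], _ => q ∈ F
  | _, _ :: _, [] => False
  | q, a :: w, Z :: s => ∃ r, next q a Z = some r ∧ Accepts next F r.1 w (r.2 ++ s)

namespace PDA

variable {Q A Γ : Type}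

/-- An automaton that works in two phases, where the pushdown does not shrink in the first and does
not grow in the second, is 1-reversal-bounded. -/
theorem reversalBounded_one_of_phases (M : PDA Q A Γ) (late : Q → Prop)
    (h₁ : ∀ q a Z r, r ∈ M.δ q a Z → ¬ late q → 1 ≤ r.2.length)
    (h₂ : ∀ q a Z r, r ∈ M.δ q a Z → late q → late r.1 ∧ r.2.length ≤ 1) :
    M.ReversalBounded 1 := by
  have hstep : ∀ c d, M.Step c d → (¬ late c.state → c.stack.length ≤ d.stack.length) ∧
      (late c.state → late d.state ∧ d.stack.length ≤ c.stack.length) := by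
    rintro _ _ (h | h)
    all_goals
      have := h₁ _ _ _ _ h
      have := h₂ _ _ _ _ h
      simp only [List.length_append, List.length_cons]
      grind
  -- Once the size no longer grows, only a preceding increase can cause one more alternation.
  have hlate : ∀ (cs : List (Config Q A Γ)) (c : Config Q A Γ) (d : Option Bool),
      (c :: cs).IsChain M.Step → late c.state →
      reversalsFrom d ((c :: cs).map fun c => c.stack.length) ≤ if d = some true then 1 else 0 := by
    intro cs
    induction cs with
    | nil => intro c d _ _; simp [reversalsFrom]
    | cons e cs ih =>
      intro c d hc hl
      obtain ⟨hs, hc⟩ := List.isChain_cons_cons.1 hc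
      obtain ⟨hl', hle⟩ := (hstep _ _ hs).2 hl
      have h0 := ih e d hc hl'
      have h1 := ih e (some false) hc hl'
      simp only [List.map_cons, reversalsFrom] at h0 h1 ⊢
      split_ifs at h0 h1 ⊢ <;> first | omega | grind
  have hearly : ∀ (cs : List (Config Q A Γ)) (c : Config Q A Γ) (d : Option Bool),
      (c :: cs).IsChain M.Step → d ≠ some false →
      reversalsFrom d ((c :: cs).map fun c => c.stack.length) ≤ 1 := by
    intro cs
    induction cs with
    | nil => intro c d _ _; simp [reversalsFrom]
    | cons e cs ih =>
      intro c d hc hd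
      by_cases hl : late c.state
      · exact (hlate _ c d hc hl).trans (by split_ifs <;> simp)
      · obtain ⟨hs, hc⟩ := List.isChain_cons_cons.1 hc
        have hle := (hstep _ _ hs).1 hl
        have h0 := ih e d hc hd
        have h1 := ih e (some true) hc (by simp)
        simp only [List.map_cons, reversalsFrom] at h0 h1 ⊢
        split_ifs <;> omega
  intro w cs ⟨hc, _, _⟩
  rcases cs with _ | ⟨c, cs⟩
  · simp [reversalsFrom]
  · exact hearly cs c none hc (by simp)

/-- Every move consumes a letter, so runs are followed by recursion on the input. The equivalences
carry the numbering of states, letters and symbols. -/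
theorem exists_accepting_iff {Q' A' Γ' : Type} (M : PDA Q' A' Γ')
    {next : Q → A → Γ → Option (Q × List Γ)} {F : List Q} (eQ : Q ≃ Q') (eA : A ≃ A') (eΓ : Γ ≃ Γ')
    (hnone : ∀ q Z, M.δ q none Z = ∅)
    (hsome : ∀ q a Z p β, (eQ p, β.map eΓ) ∈ M.δ (eQ q) (some (eA a)) (eΓ Z) ↔
      next q a Z = some (p, β))
    (hF : ∀ q, eQ q ∈ M.F ↔ q ∈ F) (q : Q) (w : List A) (s : List Γ) :
    (∃ c, Relation.ReflTransGen M.Step ⟨eQ q, w.map eA, s.map eΓ⟩ c ∧ M.Accepting c) ↔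
      Accepts next F q w s := by
  induction w generalizing q s with
  | nil =>
    refine ⟨fun ⟨c, hc, ha⟩ => ?_, fun h => ⟨_, .refl, rfl, (hF q).2 h⟩⟩
    rcases hc.cases_head with rfl | ⟨d, hd, -⟩
    · exact (hF q).1 ha.2
    · cases s with
      | nil => cases hd
      | cons Z s => cases hd; simp_all
  | cons a w ih =>
    cases s with
    | nil =>
      refine ⟨fun ⟨c, hc, ha⟩ => ?_, fun h => h.elim⟩
      rcases hc.cases_head with rfl | ⟨d, hd, -⟩
      · exact absurd ha.1 (by simp)
      · cases hd
    | cons Z s =>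
      rw [Accepts]
      constructor
      · rintro ⟨c, hc, ha⟩
        rcases hc.cases_head with rfl | ⟨d, hd, hc⟩
        · exact absurd ha.1 (by simp)
        · simp only [List.map_cons] at hd
          cases hd with
          | eps h => simp_all
          | @read _ p' _ _ _ β' _ h =>
            obtain ⟨p, rfl⟩ := eQ.surjective p'
            obtain ⟨β, rfl⟩ := eΓ.surjective.list_map β'
            refine ⟨_, (hsome _ _ _ _ _).1 h, (ih _ _).1 ⟨c, by simpa using hc, ha⟩⟩
      · rintro ⟨⟨p, β⟩, hr, h⟩
        obtain ⟨c, hc, ha⟩ := (ih _ _).2 h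
        refine ⟨c, .head (.read ((hsome _ _ _ _ _).2 hr)) (by simpa using hc), ha⟩

end PDA

namespace PDACode

variable {Q A Γ : Type} {k m n : ℕ}

/-- The description of the automaton with the transition table `T` (without moves on the empty
word) and the accepting states `F`, given numberings of states, letters and pushdown symbols. -/
abbrev ofTable (eQ : Q ≃ Fin (n + 1)) (eA : A ≃ Fin k) (eΓ : Γ ≃ Fin (m + 1)) (F : List Q)
    (T : List ((Q × Option A × Γ) × Q × List Γ)) : PDACode where
  letters := k
  states := n
  symbols := m
  final := F.map fun q => (eQ q).val
  table := T.map fun t =>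
    entry (eQ t.1.1) (some (t.1.2.1.map eA)) (eΓ t.1.2.2) (eQ t.2.1, t.2.2.map eΓ)

variable {eQ : Q ≃ Fin (n + 1)} {eA : A ≃ Fin k} {eΓ : Γ ≃ Fin (m + 1)} {F : List Q}
  {T : List ((Q × Option A × Γ) × Q × List Γ)}

theorem toPDA_ofTable_δ_none (q : Fin (n + 1)) (Z : Fin (m + 1)) :
    (ofTable eQ eA eΓ F T).toPDA.δ q none Z = ∅ := by
  ext r
  simp [toPDA, ofTable, entry]

theorem mem_toPDA_ofTable_δ (q p : Q) (a : Option A) (Z : Γ) (β : List Γ) :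
    (eQ p, β.map eΓ) ∈ (ofTable eQ eA eΓ F T).toPDA.δ (eQ q) (some (eA.optionCongr a)) (eΓ Z) ↔
      ((q, a, Z), p, β) ∈ T := by
  have hinj : Function.Injective fun t : (Q × Option A × Γ) × Q × List Γ =>
      entry (eQ t.1.1) (some (t.1.2.1.map eA)) (eΓ t.1.2.2) (eQ t.2.1, t.2.2.map eΓ) := by
    rintro ⟨⟨q, a, Z⟩, p, β⟩ ⟨⟨q', a', Z'⟩, p', β'⟩ h
    simp only [entry, Prod.mk.injEq, Fin.val_inj, EmbeddingLike.apply_eq_iff_eq, Option.map_some,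
      Option.some.injEq] at h
    obtain ⟨rfl, h, rfl, rfl, h'⟩ := h
    have := Option.map_injective eA.injective (Option.map_injective Fin.val_injective h)
    have := List.map_injective_iff.2 eΓ.injective (List.map_injective_iff.2 Fin.val_injective h')
    simp_all
  exact List.mem_map_of_injective hinj (a := ((q, a, Z), p, β))

theorem mem_language_ofTable_iff {q₀ : Q} {Z₀ : Γ} (hQ : eQ q₀ = 0) (hΓ : eΓ Z₀ = 0)
    {next : Q → Option A → Γ → Option (Q × List Γ)}
    (hT : ∀ q a Z p β, ((q, a, Z), p, β) ∈ T ↔ next q a Z = some (p, β)) (w : List (Option A)) :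
    w.map (Option.map eA) ∈ (ofTable eQ eA eΓ F T).toPDA.language ↔
      Accepts next F q₀ w [Z₀] := by
  rw [← PDA.exists_accepting_iff (ofTable eQ eA eΓ F T).toPDA eQ eA.optionCongr eΓ
    toPDA_ofTable_δ_none (fun q a Z p β => (mem_toPDA_ofTable_δ q p a Z β).trans (hT q a Z p β))
    (fun q => List.mem_map_of_injective (f := fun q => (eQ q).val)
      (Fin.val_injective.comp eQ.injective))]
  rw [hQ, List.map_singleton, hΓ]
  rfl

theorem isDPDA_one_ofTable {next : Q → Option A → Γ → Option (Q × List Γ)}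
    (hT : ∀ q a Z p β, ((q, a, Z), p, β) ∈ T ↔ next q a Z = some (p, β)) (late : Q → Prop)
    (h₁ : ∀ q a Z r, next q a Z = some r → ¬ late q → 1 ≤ r.2.length)
    (h₂ : ∀ q a Z r, next q a Z = some r → late q → late r.1 ∧ r.2.length ≤ 1) :
    (ofTable eQ eA eΓ F T).IsDPDA 1 := by
  have hδ : ∀ q a Z r, r ∈ (ofTable eQ eA eΓ F T).toPDA.δ q a Z → ∃ q' a' Z' p β,
      eQ q' = q ∧ some (eA.optionCongr a') = a ∧ eΓ Z' = Z ∧ (eQ p, β.map eΓ) = r ∧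
        next q' a' Z' = some (p, β) := by
    rintro q (_ | a) Z ⟨p, β⟩ h
    · exact ((toPDA_ofTable_δ_none q Z).subset h).elim
    · obtain ⟨q, rfl⟩ := eQ.surjective q
      obtain ⟨p, rfl⟩ := eQ.surjective p
      obtain ⟨a, rfl⟩ := eA.optionCongr.surjective a
      obtain ⟨Z, rfl⟩ := eΓ.surjective Z
      obtain ⟨β, rfl⟩ := eΓ.surjective.list_map β
      exact ⟨q, a, Z, p, β, rfl, rfl, rfl, rfl,
        (hT _ _ _ _ _).1 ((mem_toPDA_ofTable_δ _ _ _ _ _).1 h)⟩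
  refine ⟨⟨fun q a Z r hr r' hr' => ?_, fun q Z h => ?_⟩,
    PDA.reversalBounded_one_of_phases _ (fun q => late (eQ.symm q)) ?_ ?_⟩
  · obtain ⟨q', a', Z', p, β, rfl, rfl, rfl, rfl, h⟩ := hδ _ _ _ _ hr
    obtain ⟨q'', a'', Z'', p', β', hq, ha, hZ, rfl, h'⟩ := hδ _ _ _ _ hr'
    obtain rfl := eQ.injective hq
    obtain rfl := eA.optionCongr.injective (Option.some.inj ha)
    obtain rfl := eΓ.injective hZ
    rw [h] at h'
    cases h'
    rfl
  · obtain ⟨r, h⟩ := h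
    exact ((toPDA_ofTable_δ_none q Z).subset h).elim
  · intro q a Z r hr hl
    obtain ⟨q', a', Z', p, β, rfl, rfl, rfl, rfl, h⟩ := hδ _ _ _ _ hr
    exact (h₁ _ _ _ _ h (by simpa using hl)).trans_eq (List.length_map _).symm
  · intro q a Z r hr hl
    obtain ⟨q', a', Z', p, β, rfl, rfl, rfl, rfl, h⟩ := hδ _ _ _ _ hr
    have := h₂ _ _ _ _ h (by simpa using hl)
    exact ⟨by simpa using this.1, (List.length_map _).trans_le this.2⟩

/-- Only the word pushed by the first table entry varies with `i`; all other data are constants,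
however they were chosen. -/
theorem computable_ofTable_cons (t : Q × Option A × Γ) (p : Q) {β : ℕ → List Γ} {a b : List ℕ}
    {x : ℕ} (hβ : ∀ i, (β i).map (fun Z => (eΓ Z).val) = a ++ List.replicate i x ++ b) :
    Computable fun i => ofTable eQ eA eΓ F ((t, p, β i) :: T) := by
  have hrep : Primrec fun i => a ++ List.replicate i x ++ b := by
    refine (Primrec.list_append.comp (Primrec.list_append.comp (Primrec.const a)
      (Primrec.list_map Primrec.list_range (Primrec.const x).to₂)) (Primrec.const b)).of_eq ?_
    simp
  have hmk : Primrec equivProd.symm := Primrec.of_equiv_symm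
  have : Primrec fun i => equivProd.symm (k, n, m, F.map (fun q => (eQ q).val),
      ((eQ t.1).val, some ((t.2.1.map eA).map Fin.val), (eΓ t.2.2).val, (eQ p).val,
        a ++ List.replicate i x ++ b) :: (ofTable eQ eA eΓ F T).table) := by
    refine hmk.comp ((Primrec.const k).pair ((Primrec.const n).pair ((Primrec.const m).pair
      ((Primrec.const _).pair (Primrec.list_cons.comp ?_ (Primrec.const _))))))
    exact (Primrec.const _).pair ((Primrec.const _).pair ((Primrec.const _).pair
      ((Primrec.const _).pair hrep)))
  refine (this.of_eq fun i => ?_).to_comp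
  simp [equivProd, ofTable, entry, ← hβ]

end PDACode

/-! ### Marked density of languages of words with one letter before the first marker -/

section MarkedDensity

variable {A : Type} {L : Language (Option A)}

/-- All words have the form `a $ w $` with a letter `a` and a word `w` over the unmarked
alphabet. -/
def OneLetterPrefixed (L : Language (Option A)) : Prop :=
  ∀ v ∈ L, ∃ (a : A) (w : List A), v = some a :: none :: (w.map some ++ [none])

theorem OneLetterPrefixed.markedDense_suff_iff (hL : OneLetterPrefixed L) :
    MarkedDense suff L ↔ ∀ w : List A, ∃ a : A, some a :: none :: (w.map some ++ [none]) ∈ L := by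
  refine forall_congr' fun w => ⟨fun ⟨x, hx⟩ => ?_, fun ⟨a, ha⟩ => ⟨[some a], ha⟩⟩
  obtain ⟨a, w', h⟩ := hL _ hx
  rcases x with _ | ⟨b, _ | ⟨c, x⟩⟩
  · simp at h
  · obtain rfl : b = some a := by simp at h; exact h.1
    exact ⟨a, hx⟩
  · simp only [List.cons_append, List.cons.injEq] at h
    -- If two letters or more precede `$w$`, they use up the first marker, and only one is left for
    -- the two of `$w$`.
    have := congrArg (List.countP Option.isNone) h.2.2
    simp [Function.comp_def] at this

theorem OneLetterPrefixed.markedDense_infx_iff (hL : OneLetterPrefixed L) :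
    MarkedDense infx L ↔ ∀ w : List A, ∃ a : A, some a :: none :: (w.map some ++ [none]) ∈ L := by
  rw [← hL.markedDense_suff_iff]
  refine forall_congr' fun w => ⟨fun ⟨x, y, hxy⟩ => ?_, fun ⟨x, hx⟩ => ⟨x, [], by simpa using hx⟩⟩
  obtain ⟨a, w', h⟩ := hL _ hxy
  rcases List.eq_nil_or_concat y with rfl | ⟨y, b, rfl⟩
  · exact ⟨x, by simpa using hxy⟩
  · have h' : (x ++ ([none] ++ w.map some ++ [none]) ++ y) ++ [b] =
        (some a :: none :: w'.map some) ++ [none] := by simpa using h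
    -- Without its last letter a word of `L` has a single marker, too few to contain `$w$`.
    have := congrArg (List.countP Option.isNone) (List.append_inj' h' rfl).1
    simp [Function.comp_def] at this
    omega

theorem OneLetterPrefixed.markedDense_outf_iff (hL : OneLetterPrefixed L) :
    MarkedDense outf L ↔ ∀ w : List A, ∃ a : A, some a :: none :: (w.map some ++ [none]) ∈ L := by
  rw [← hL.markedDense_suff_iff]
  refine forall_congr' fun w => ⟨fun ⟨x, u, y, hv, hxy⟩ => ?_,
    fun ⟨x, hx⟩ => ⟨[], x, _, rfl, hx⟩⟩
  obtain ⟨a, w', h⟩ := hL _ hxy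
  rcases x with _ | ⟨b, x⟩
  · exact ⟨u, by rw [hv]; simpa using hxy⟩
  -- A nonempty `x` would begin with the marker, as a prefix of `$w$`, and with a letter, as a
  -- prefix of a word of `L`.
  · simp_all

end MarkedDensity

/-! ### An automaton checking candidates for solutions of a correspondence problem -/

/-- The input letters: two selecting one of the words to be checked, a separator, and letters for
the dominoes and for the symbols on them. -/
inductive CheckLetter (I B : Type) : Type
  | sel (b : Bool)
  | sep
  | dom (i : I)
  | sym (c : B)

/-- The states. -/
inductive CheckState : Type
  | start
  | sel (b : Bool)
  | push (b : Bool)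
  | pop (b : Bool)
  | bad
  | acc

instance {I B : Type} [Finite I] [Finite B] : Finite (CheckLetter I B) :=
  Finite.of_injective (β := (Bool ⊕ Unit) ⊕ I ⊕ B)
    (fun c => match c with
      | .sel b => .inl (.inl b)
      | .sep => .inl (.inr ())
      | .dom i => .inr (.inl i)
      | .sym c => .inr (.inr c))
    (by rintro (_ | _ | _ | _) (_ | _ | _ | _) h <;> simp_all)

instance : Finite CheckState :=
  Finite.of_injective (β := Fin 3 × Bool ⊕ Fin 3)
    (fun c => match c with
      | .start => .inr 0
      | .sel b => .inl (0, b)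
      | .push b => .inl (1, b)
      | .pop b => .inl (2, b)
      | .bad => .inr 1
      | .acc => .inr 2)
    (by rintro (_ | _ | _ | _ | _ | _) (_ | _ | _ | _ | _ | _) h <;> simp_all)

namespace CheckState

open CheckLetter

variable {I B : Type}

open Classical in
/-- On an input `b $ i₁ … iₖ # v $`, the automaton rejects if and only if `v` is the reversal of the
word made of a first word (which is `p` for `b = true` and empty for `b = false`), of
`img b i₁ … img b iₖ`, and of `fin b`. The bottom of the pushdown is `none`. -/
noncomputable def next (img : Bool → I → List B) (fin : Bool → List B) (p : List B) :
    CheckState → Option (CheckLetter I B) → Option B → Option (CheckState × List (Option B))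
  | start, some (.sel b), z => some (sel b, [z])
  -- Restricting to the bottom symbol makes this the only transition that depends on `p`.
  | sel true, none, none => some (push true, p.reverse.map some ++ [none])
  | sel false, none, z => some (push false, [z])
  | push b, some (.dom i), z => some (push b, (img b i).reverse.map some ++ [z])
  | push b, some .sep, z => some (pop b, (fin b).reverse.map some ++ [z])
  | push _, some _, z => some (bad, [z])
  | push _, none, z => some (acc, [z])
  | pop b, some (.sym c), some d => some (if c = d then (pop b, []) else (bad, [some d]))
  | pop _, some _, z => some (bad, [z])
  | pop _, none, some d => some (acc, [some d])
  | bad, some _, z => some (bad, [z])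
  | bad, none, z => some (acc, [z])
  -- This includes `pop` reading the marker at the bottom symbol, where the test has succeeded, and
  -- every move from `acc`, so that nothing can follow the second marker.
  | _, _, _ => none

/-- The states in which the pushdown does not grow any more. -/
def late : CheckState → Prop
  | start | sel _ | push _ => False
  | _ => True

variable {img : Bool → I → List B} {fin : Bool → List B} {p : List B}

theorem one_le_length_of_next {q : CheckState} {a : Option (CheckLetter I B)} {z : Option B}
    {r : CheckState × List (Option B)} (h : next img fin p q a z = some r) (hq : ¬ q.late) :
    1 ≤ r.2.length := by
  cases q <;> simp only [late, not_true_eq_false, not_false_eq_true] at hq <;>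
    (unfold next at h; split at h <;> simp_all <;> subst h <;> simp)

theorem length_le_one_of_next {q : CheckState} {a : Option (CheckLetter I B)} {z : Option B}
    {r : CheckState × List (Option B)} (h : next img fin p q a z = some r) (hq : q.late) :
    r.1.late ∧ r.2.length ≤ 1 := by
  cases q <;> simp only [late] at hq <;>
    (unfold next at h; split at h <;> simp_all <;> subst h <;> (try split_ifs) <;> simp [late])

/-- Acceptance by the checking automaton. -/
abbrev Acc (img : Bool → I → List B) (fin : Bool → List B) (p : List B) :=
  Accepts (next img fin p) [acc]

theorem eq_nil_of_accepts_acc {w : List (Option (CheckLetter I B))} {s : List (Option B)}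
    (h : Acc img fin p acc w s) : w = [] := by
  rcases w with _ | ⟨a, w⟩
  · rfl
  · rcases s with _ | ⟨z, s⟩
    · exact h.elim
    · obtain ⟨r, hr, -⟩ := h
      simp [next] at hr

/-- Every run from the states reached after the first marker ends with the second one. -/
theorem exists_of_accepts {q : CheckState} (hq : (∃ b, q = push b) ∨ (∃ b, q = pop b) ∨ q = bad)
    {w : List (Option (CheckLetter I B))} {s : List (Option B)} (h : Acc img fin p q w s) :
    ∃ w' : List (CheckLetter I B), w = w'.map some ++ [none] := by
  induction w generalizing q s with
  | nil =>
    have : q = acc := by simpa [Acc, Accepts] using h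
    simp [this] at hq
  | cons a w ih =>
    rcases s with _ | ⟨z, s⟩
    · exact h.elim
    obtain ⟨r, hr, h⟩ := h
    rcases a with _ | a
    · have : r.1 = acc := by
        rcases hq with ⟨b, rfl⟩ | ⟨b, rfl⟩ | rfl
        · simp [next] at hr; simp [← hr]
        · rcases z <;> simp [next] at hr; simp [← hr]
        · simp [next] at hr; simp [← hr]
      rw [this] at h
      exact ⟨[], by simp [eq_nil_of_accepts_acc h]⟩
    · have : (∃ b, r.1 = push b) ∨ (∃ b, r.1 = pop b) ∨ r.1 = bad := by
        rcases hq with ⟨b, rfl⟩ | ⟨b, rfl⟩ | rfl <;>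
          (unfold next at hr; split at hr <;> simp_all <;> subst hr <;> (try split_ifs) <;> simp)
      obtain ⟨w', rfl⟩ := ih this h
      exact ⟨a :: w', rfl⟩

theorem exists_of_accepts_start {w : List (Option (CheckLetter I B))}
    (h : Acc img fin p start w [none]) :
    ∃ (b : Bool) (w' : List (CheckLetter I B)),
      w = some (.sel b) :: none :: (w'.map some ++ [none]) := by
  rcases w with _ | ⟨_ | (b | _ | _ | _), _ | ⟨_ | a, w⟩⟩ <;>
    try (simp [Acc, Accepts, next] at h; done)
  obtain ⟨_, h₁, h⟩ := h
  cases h₁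
  obtain ⟨r, h₂, h⟩ := h
  refine ⟨b, ?_⟩
  have : ∃ b, r.1 = push b := by
    cases b <;> obtain rfl := Option.some.inj h₂ <;> exact ⟨_, rfl⟩
  obtain ⟨w', rfl⟩ := exists_of_accepts (.inl this) h
  exact ⟨w', rfl⟩

theorem accepts_bad (w : List (CheckLetter I B)) (z : Option B) (s : List (Option B)) :
    Acc img fin p bad (w.map some ++ [none]) (z :: s) := by
  induction w with
  | nil => simp [Acc, Accepts, next]
  | cons a w ih => simpa [Acc, Accepts, next] using ih

/-- A wrong letter or one too many leads to `bad`; a marker read too early leads to `acc`. -/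
theorem accepts_pop_iff (b : Bool) (w : List (CheckLetter I B)) (t : List B) :
    Acc img fin p (pop b) (w.map some ++ [none]) (t.map some ++ [none]) ↔
      w ≠ t.map CheckLetter.sym := by
  induction w generalizing t with
  | nil => cases t <;> simp [Acc, Accepts, next]
  | cons a w ih =>
    have hbad : ∀ z s, Accepts (next img fin p) [acc] bad (w.map some ++ [none]) (z :: s) :=
      fun z s => accepts_bad w z s
    rcases t with _ | ⟨d, t⟩
    · rcases a with _ | _ | _ | c <;> simp [Acc, Accepts, next, hbad]
    · rcases a with _ | _ | _ | c
      on_goal 4 =>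
        by_cases hc : c = d
        · simpa [Acc, Accepts, next, hc] using ih t
      all_goals simp_all [Acc, Accepts, next]

/-- The words on which the automaton finds no error. -/
def Correct (img : Bool → I → List B) (fin : Bool → List B) (b : Bool) (p : List B)
    (w : List (CheckLetter I B)) : Prop :=
  ∃ u : List I, w = u.map dom ++ CheckLetter.sep ::
    (p ++ u.flatMap (img b) ++ fin b).reverse.map CheckLetter.sym

/-- Here `t` is what has been pushed so far. Reading a domino `i` turns it into `t ++ img b i`, so
the induction must leave `t` free. -/
theorem accepts_push_iff (b : Bool) (w : List (CheckLetter I B)) (t : List B) :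
    Acc img fin p (push b) (w.map some ++ [none]) (t.reverse.map some ++ [none]) ↔
      ¬ Correct img fin b t w := by
  have hne : ∀ t : List B, ∃ z s, t.reverse.map some ++ [none] = z :: s := fun t =>
    List.exists_cons_of_ne_nil (by simp)
  induction w generalizing t with
  | nil =>
    obtain ⟨z, s, h⟩ := hne t
    rw [h]
    simp [Acc, Accepts, next, Correct]
  | cons a w ih =>
    have hbad : ∀ z s, Accepts (next img fin p) [acc] bad (w.map some ++ [none]) (z :: s) :=
      fun z s => accepts_bad w z s
    obtain ⟨z, s, h⟩ := hne t
    rcases a with _ | _ | i | c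
    · rw [h]
      simp [Acc, Accepts, next, Correct, hbad]
      rintro (_ | _) <;> simp
    · have := accepts_pop_iff (img := img) (fin := fin) (p := p) b w (t ++ fin b).reverse
      rw [List.reverse_append, List.map_append, List.append_assoc, h] at this
      rw [h]
      simp only [Acc, Accepts, next, List.map_cons, List.cons_append, Option.some.injEq,
        exists_eq_left', List.append_assoc, List.nil_append] at this ⊢
      rw [this]
      refine not_congr ⟨fun hw => ⟨[], by simp [hw]⟩, ?_⟩
      rintro ⟨_ | ⟨i, u⟩, hu⟩
      · simpa using hu
      · simp at hu
    · have := ih (t ++ img b i)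
      rw [List.reverse_append, List.map_append, List.append_assoc, h] at this
      rw [h]
      simp only [Acc, Accepts, next, List.map_cons, List.cons_append, Option.some.injEq,
        exists_eq_left', List.append_assoc, List.nil_append] at this ⊢
      refine this.trans (not_congr ⟨?_, ?_⟩)
      · rintro ⟨u, rfl⟩
        exact ⟨i :: u, by simp⟩
      · rintro ⟨_ | ⟨j, u⟩, hu⟩
        · simp at hu
        · simp only [List.map_cons, List.cons_append, List.cons.injEq, dom.injEq] at hu
          obtain ⟨rfl, rfl⟩ := hu
          exact ⟨u, by simp⟩
    · rw [h]
      simp [Acc, Accepts, next, Correct, hbad]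
      rintro (_ | _) <;> simp

theorem accepts_start_iff (b : Bool) (w : List (CheckLetter I B)) :
    Acc img fin p start (some (.sel b) :: none :: (w.map some ++ [none])) [none] ↔
      ¬ Correct img fin b (if b then p else []) w := by
  rw [← accepts_push_iff (p := p)]
  cases b <;> simp [Acc, Accepts, next]

/-- The separator determines the dominoes `u`, so a word passing both tests uses the same `u` and
the same `v` for both. -/
theorem exists_correct_iff :
    (∃ w, Correct img fin true p w ∧ Correct img fin false [] w) ↔
      ∃ u : List I, p ++ u.flatMap (img true) ++ fin true = u.flatMap (img false) ++ fin false := by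
  have hinj : ∀ {u v : List I} {x y : List (CheckLetter I B)},
      u.map dom ++ CheckLetter.sep :: x = v.map dom ++ CheckLetter.sep :: y → u = v ∧ x = y := by
    intro u
    induction u with
    | nil => rintro (_ | _) x y h <;> simp_all
    | cons i u ih =>
      rintro (_ | ⟨j, v⟩) x y h
      · simp at h
      · simp only [List.map_cons, List.cons_append, List.cons.injEq, dom.injEq] at h
        simpa [h.1] using ih h.2
  constructor
  · rintro ⟨_, ⟨u, rfl⟩, v, h⟩
    obtain ⟨rfl, h⟩ := hinj h
    have hsym : Function.Injective (CheckLetter.sym : B → CheckLetter I B) := fun _ _ h => by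
      cases h; rfl
    exact ⟨u, by simpa using List.reverse_injective (List.map_injective_iff.2 hsym h)⟩
  · rintro ⟨u, hu⟩
    exact ⟨_, ⟨u, rfl⟩, u, by rw [hu, List.nil_append]⟩

end CheckState

/-! ### The reduction -/

/-- The elements of a finite type with a distinguished point can be numbered from `0`, with the
point first. -/
theorem exists_numbering (α : Type) [Finite α] (a : α) :
    ∃ (n : ℕ) (e : α ≃ Fin (n + 1)), e a = 0 := by
  obtain ⟨n, ⟨e⟩⟩ := Finite.exists_equiv_fin α
  rcases n with _ | n
  · exact (e a).elim0
  · exact ⟨n, e.trans (Equiv.swap (e a) 0), by simp⟩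

/-- A decision procedure on a promise yields one for a predicate on numbers, by a computable
reduction into the promise. -/
theorem undecidableGiven_of_reduction {α : Type} [Primcodable α] {promise P : α → Prop}
    {p : ℕ → Prop} (hp : ¬ ComputablePred p) (f : ℕ → α) (hf : Computable f)
    (hpromise : ∀ n, promise (f n)) (hP : ∀ n, P (f n) ↔ ¬ p n) : UndecidableGiven promise P := by
  rintro ⟨g, hg, h⟩
  refine hp ((ComputablePred.computable_iff.2 ?_ : ComputablePred fun n => ¬ p n).not.of_eq
    fun n => not_not)
  choose b hb hbP using fun n => h (f n) (hpromise n)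
  exact ⟨b, Partrec.of_eq_tot (hg.comp hf) hb,
    funext fun n => propext ((hP n).symm.trans (hbP n).symm)⟩

open CheckState in
/-- There is a computable family of deterministic 1-reversal-bounded automata whose languages
consist of words with one letter before the first marker, such that it is undecidable whether all
words between markers can be completed. -/
theorem exists_family :
    ∃ (p : ℕ → Prop) (D : ℕ → PDACode), ¬ ComputablePred p ∧ Computable D ∧
      (∀ n, (D n).IsDPDA 1) ∧ (∀ n, OneLetterPrefixed (D n).toPDA.language) ∧
      ∀ n, (∀ w : List (Fin (D n).letters), ∃ a,
        some a :: none :: (w.map some ++ [none]) ∈ (D n).toPDA.language) ↔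
        ¬ p n := by
  classical
  obtain ⟨I, B, _, _, up, lo, a, x, b, s, hp⟩ := Correspondence.exists_undecidable
  let img : Bool → I → List B := fun c => if c then lo else up
  let fin : Bool → List B := fun c => if c then [] else s
  let first : ℕ → List B := fun n => a ++ List.replicate n x ++ b
  obtain ⟨nQ, eQ, hQ⟩ := exists_numbering CheckState .start
  obtain ⟨k, ⟨eA⟩⟩ := Finite.exists_equiv_fin (CheckLetter I B)
  obtain ⟨nΓ, eΓ, hΓ⟩ := exists_numbering (Option B) none
  -- The one transition that varies with `n`; the finite rest `T` of the table is taken from `next`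
  -- with an empty first word.
  let key : CheckState × Option (CheckLetter I B) × Option B := (.sel true, none, none)
  have hfin : {t : (CheckState × Option (CheckLetter I B) × Option B) ×
      CheckState × List (Option B) |
      t.1 ≠ key ∧ next img fin [] t.1.1 t.1.2.1 t.1.2.2 = some t.2}.Finite := by
    refine Set.Finite.of_injOn (f := Prod.fst) (t := Set.univ) (fun _ _ => trivial) ?_
      (Set.toFinite _)
    rintro ⟨t, r⟩ ⟨-, h⟩ ⟨t', r'⟩ ⟨-, h'⟩ (rfl : t = t')
    simp only at h h'
    rw [h] at h'
    cases h'
    rfl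
  let T := hfin.toFinset.toList
  let T' : ℕ → List ((CheckState × Option (CheckLetter I B) × Option B) ×
      CheckState × List (Option B)) := fun n =>
    (key, .push true, (first n).reverse.map some ++ [none]) :: T
  have hT : ∀ n q a z p β, ((q, a, z), p, β) ∈ T' n ↔
      next img fin (first n) q a z = some (p, β) := by
    intro n q a z p β
    by_cases h : (q, a, z) = key
    · simp only [key, Prod.mk.injEq] at h
      obtain ⟨rfl, rfl, rfl⟩ := h
      simp [T', T, key, next, eq_comm]
    · have h' : next img fin (first n) q a z = next img fin [] q a z := by
        unfold next
        split <;> simp_all [key]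
      simp [T', T, h, h']
  let D : ℕ → PDACode := fun n => PDACode.ofTable eQ eA eΓ [acc] (T' n)
  have hlang : ∀ n w, w.map (Option.map eA) ∈ (D n).toPDA.language ↔
      Acc img fin (first n) start w [none] := fun n w =>
    PDACode.mem_language_ofTable_iff hQ hΓ (hT n) w
  refine ⟨_, D, hp, ?_, fun n => ?_, fun n => ?_, fun n => ?_⟩
  -- The first word is pushed reversed, so `b` comes before the copies of `x` and `a` after them,
  -- above the bottom symbol.
  · refine PDACode.computable_ofTable_cons key _
      (a := b.reverse.map fun c => (eΓ (some c)).val) (x := (eΓ (some x)).val)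
      (b := a.reverse.map (fun c => (eΓ (some c)).val) ++ [(eΓ none).val]) fun i => ?_
    simp [first, Function.comp_def]
  · exact PDACode.isDPDA_one_ofTable (hT n) late (fun _ _ _ _ => one_le_length_of_next)
      fun _ _ _ _ => length_le_one_of_next
  · intro v hv
    obtain ⟨v, rfl⟩ := (eA.optionCongr.surjective.list_map) v
    obtain ⟨c, w, rfl⟩ := exists_of_accepts_start ((hlang n v).1 hv)
    exact ⟨eA (.sel c), w.map eA, by simp [Function.comp_def]⟩
  · have hmem : ∀ (c : CheckLetter I B) (w : List (CheckLetter I B)),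
        some (eA c) :: none :: ((w.map eA).map some ++ [none]) ∈ (D n).toPDA.language ↔
          ∃ b, c = .sel b ∧ ¬ Correct img fin b (if b then first n else []) w := by
      intro c w
      have := hlang n (some c :: none :: (w.map some ++ [none]))
      simp only [List.map_cons, List.map_append, List.map_map, Option.map_some, Option.map_none,
        List.map_nil, Function.comp_def] at this ⊢
      refine this.trans ⟨fun h => ?_, ?_⟩
      · obtain ⟨b, w', h'⟩ := exists_of_accepts_start h
        obtain rfl : c = .sel b := by simpa using (List.cons.inj h').1
        exact ⟨b, rfl, (accepts_start_iff b w).1 h⟩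
      · rintro ⟨b, rfl, h⟩
        exact (accepts_start_iff b w).2 h
    have hsol := exists_correct_iff (img := img) (fin := fin) (p := first n)
    simp only [img, fin, if_true, Bool.false_eq_true, if_false, List.append_nil] at hsol
    rw [← hsol, not_exists]
    rw [eA.surjective.list_map.forall]
    refine forall_congr' fun w => ?_
    rw [eA.surjective.exists]
    simp only [hmem]
    rw [not_and_or]
    constructor
    · rintro ⟨c, b, rfl, h⟩
      cases b
      · exact .inr h
      · exact .inl h
    · rintro (h | h)
      · exact ⟨_, true, rfl, h⟩
      · exact ⟨_, false, rfl, h⟩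

theorem proposition6 :
    UndecidableGiven (PDACode.IsDPDA 1) (fun D => MarkedDense suff D.toPDA.language) ∧
    UndecidableGiven (PDACode.IsDPDA 1) (fun D => MarkedDense infx D.toPDA.language) ∧
    UndecidableGiven (PDACode.IsDPDA 1) (fun D => MarkedDense outf D.toPDA.language) := by
  obtain ⟨p, D, hp, hD, h₁, h₂, h⟩ := exists_family
  exact ⟨undecidableGiven_of_reduction hp D hD h₁ fun n => (h₂ n).markedDense_suff_iff.trans (h n),
    undecidableGiven_of_reduction hp D hD h₁ fun n => (h₂ n).markedDense_infx_iff.trans (h n),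
    undecidableGiven_of_reduction hp D hD h₁ fun n => (h₂ n).markedDense_outf_iff.trans (h n)⟩
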